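/- Let $n\ge 1$, let $X$ be a topological space and $x_0\in X$ a basepoint. Let $X^{S^n}$ be the space of all continuous maps $S^n\to X$ with the compact-open topology, and let $X^{S^n}_0=\{f\in X^{S^n} : x_0\in f(S^n)\}$ be the subspace of maps passing through the basepoint. Say that $X$ has numerable category if it has an open cover $(U_i)_{i\in I}$ that admits a subordinate locally finite partition of unity and is such that every inclusion $U_i\hookrightarrow X$ is homotopic to a constant map. (1) If $X$ is path connected and has numerable category, then the inclusion $X^{S^n}_0\subset X^{S^n}$ is a homotopy equivalence. (2) In particular, this applies to connected CW complexes: if $X$ is a connected CW complex, then $X$ is path connected and has numerable category, and hence the inclusion $X^{S^n}_0\subset X^{S^n}$ is a homotopy equivalence. -/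

import Mathlib

universe u

/-- The unit `n`-sphere in `ℝⁿ⁺¹`. -/
abbrev UnitSphere (n : ℕ) : Type :=
  Metric.sphere (0 : EuclideanSpace ℝ (Fin (n + 1))) 1

/-- `X` has numerable category: it admits a numerable open cover (one with a subordinate locally
finite partition of unity) by sets whose inclusion into `X` is homotopic to a constant map. -/
def HasNumerableCategory (X : Type u) [TopologicalSpace X] : Prop :=
  ∃ (ι : Type u) (U : ι → Set X),
    (∀ i, IsOpen (U i)) ∧
    (∀ i, (ContinuousMap.mk (Subtype.val : U i → X) continuous_subtype_val).Nullhomotopic) ∧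
    ∃ ρ : PartitionOfUnity ι X, ρ.IsSubordinate U

/-- The maps `Sⁿ → X` passing through the point `x₀`, as a subset of the space `C(Sⁿ, X)` of all
continuous maps with the compact-open topology. -/
def mapsThrough (n : ℕ) {X : Type u} [TopologicalSpace X] (x₀ : X) : Set C(UnitSphere n, X) :=
  {f | ∃ s, f s = x₀}

/-- The inclusion of the maps passing through `x₀`, with the subspace topology, into all maps. -/
def mapsThroughInclusion (n : ℕ) {X : Type u} [TopologicalSpace X] (x₀ : X) :
    C(mapsThrough n x₀, C(UnitSphere n, X)) :=
  ⟨Subtype.val, continuous_subtype_val⟩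

/-- A continuous map is a homotopy equivalence if it has a two-sided homotopy inverse. -/
def IsHomotopyEquivalence {A B : Type*} [TopologicalSpace A] [TopologicalSpace B]
    (f : C(A, B)) : Prop :=
  ∃ g : C(B, A), (g.comp f).Homotopic (ContinuousMap.id A) ∧
    (f.comp g).Homotopic (ContinuousMap.id B)

open Set Filter Topology unitInterval

/-! The first claim rests on a continuous family of paths `W (x, ·)`, starting at `x` and each
meeting `x₀` (`exists_paths_through`). Path connectedness lets every set of the cover be contracted
to `x₀`. Order the indices, cut `[0, 1]` into consecutive intervals of lengths `ρ i x`, and on the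
`i`-th one run the `i`-th contraction forwards and back; a rescaling ensures that at least one
excursion reaches `x₀`.

Given `f` on the sphere, collapse a hemisphere to its pole `-e` by a homotopy, then let that
hemisphere trace the path `W (f (-e), ·)`, with latitude as time. The final map hits `x₀`. At every
stage all values of `f` are still attained, so maps through `x₀` stay such, and
`isHomotopyEquivalence_of_deformation` applies.

In a CW complex, points flow radially out of their cells into lower ones. The open set where
`cwHeight k < cwHeight (k + 1)` flows into the disjoint union of the open `k`-cells, which contracts
to the centres and then, along paths, to one point. Since the heights increase from `0` to `1` in
finitely many steps at each point, these sets carry a locally finite partition of unity. -/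

/-! ### Contractions to the basepoint and their gluing. -/

theorem exists_contraction_of_nullhomotopic {X : Type*} [TopologicalSpace X]
    [PathConnectedSpace X] (x₀ : X) {U : Set X}
    (hU : (ContinuousMap.mk (Subtype.val : U → X) continuous_subtype_val).Nullhomotopic) :
    ∃ γ : X × I → X, ContinuousOn γ (U ×ˢ univ) ∧ (∀ x, γ (x, 0) = x) ∧
      ∀ x ∈ U, γ (x, 1) = x₀ := by
  classical
  obtain ⟨y, ⟨F⟩⟩ := hU
  let p : Path y x₀ := PathConnectedSpace.somePath y x₀
  let P : (ContinuousMap.const U y).Homotopy (ContinuousMap.const U x₀) :=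
    { toFun := fun q => p q.1
      continuous_toFun := by fun_prop
      map_zero_left := by simp
      map_one_left := by simp }
  let K := F.trans P
  -- The default `q.1` off `U` keeps the condition at time `0` valid for every `x`.
  refine ⟨fun q => if h : q.1 ∈ U then K (q.2, ⟨q.1, h⟩) else q.1, ?_, ?_, ?_⟩
  · rw [continuousOn_iff_continuous_domRestrict]
    have : Continuous fun q : (U ×ˢ (univ : Set I) : Set (X × I)) =>
        K (q.1.2, ⟨q.1.1, q.2.1⟩) := by
      refine K.continuous.comp ?_
      fun_prop
    convert this using 2 with q
    simp [q.2.1]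
  · intro x
    by_cases h : x ∈ U <;> simp [h]
  · intro x h
    simp [h]

/-- Where all `h i` vanish, only finitely many indices matter nearby. Each either vanishes near the
point or has it in the closure of its support, where `γ i` is continuous and starts at `q y`. -/
theorem exists_continuous_glue {Y X ι : Type*} [TopologicalSpace Y] [TopologicalSpace X]
    {q : Y → X} (hq : Continuous q) {h : ι → Y → I} (hc : ∀ i, Continuous (h i))
    (lf : LocallyFinite fun i => {y | h i y ≠ 0}) {U : ι → Set X} (hU : ∀ i, IsOpen (U i))
    (hsub : ∀ i, ∀ y ∈ closure {y | h i y ≠ 0}, q y ∈ U i)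
    (hdisj : ∀ i j y, h i y ≠ 0 → h j y ≠ 0 → i = j)
    {γ : ι → X × I → X} (hγ : ∀ i, ContinuousOn (γ i) (U i ×ˢ univ))
    (hγ0 : ∀ i x, γ i (x, 0) = x) :
    ∃ W : Y → X, Continuous W ∧ (∀ y, (∀ i, h i y = 0) → W y = q y) ∧
      ∀ i y, h i y ≠ 0 → W y = γ i (q y, h i y) := by
  classical
  let W : Y → X := fun y => if H : ∃ i, h i y ≠ 0 then γ H.choose (q y, h H.choose y) else q y
  have hW0 : ∀ y, (∀ i, h i y = 0) → W y = q y := by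
    intro y hy
    have : ¬ ∃ i, h i y ≠ 0 := by simpa using hy
    simp only [W, dif_neg this]
  have hW1 : ∀ i y, h i y ≠ 0 → W y = γ i (q y, h i y) := by
    intro i y hy
    have H : ∃ i, h i y ≠ 0 := ⟨i, hy⟩
    have : H.choose = i := hdisj _ _ y H.choose_spec hy
    simp only [W, dif_pos H]
    rw [this]
  have hcont : ∀ i y, q y ∈ U i → ContinuousAt (fun y => γ i (q y, h i y)) y := by
    intro i y hy
    have h1 : ContinuousAt (γ i) (q y, h i y) :=
      (hγ i).continuousAt (((hU i).prod isOpen_univ).mem_nhds ⟨hy, mem_univ _⟩)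
    exact ContinuousAt.comp (f := fun y => (q y, h i y)) h1 (hq.prodMk (hc i)).continuousAt
  have hne : ∀ i, IsOpen {y | h i y ≠ 0} := fun i => isOpen_ne_fun (hc i) continuous_const
  refine ⟨W, continuous_iff_continuousAt.2 fun y => ?_, hW0, hW1⟩
  by_cases H : ∃ i, h i y ≠ 0
  · obtain ⟨i, hi⟩ := H
    refine (hcont i y (hsub i y (subset_closure hi))).congr ?_
    filter_upwards [(hne i).mem_nhds hi] with z hz using (hW1 i z hz).symm
  · push Not at H
    rw [ContinuousAt, hW0 y H]
    intro V hV
    obtain ⟨N, hN, hfin⟩ := lf y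
    have key : ∀ᶠ z in 𝓝 y, ∀ i ∈ {i | ({y | h i y ≠ 0} ∩ N).Nonempty},
        h i z ≠ 0 → γ i (q z, h i z) ∈ V := by
      refine (eventually_all_finite hfin).2 fun i _ => ?_
      by_cases hy : y ∈ closure {y | h i y ≠ 0}
      · have := hcont i y (hsub i y hy)
        rw [ContinuousAt, H i, hγ0] at this
        filter_upwards [this hV] with z hz _ using hz
      · filter_upwards [isClosed_closure.isOpen_compl.mem_nhds hy] with z hz hz'
        exact absurd (subset_closure hz') hz
    rw [mem_map]
    filter_upwards [key, hN, hq.continuousAt.preimage_mem_nhds hV] with z hz hzN hzV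
    rw [mem_preimage]
    by_cases H' : ∃ i, h i z ≠ 0
    · obtain ⟨i, hi⟩ := H'
      rw [hW1 i z hi]
      exact hz i ⟨z, hi, hzN⟩ hi
    · push Not at H'
      rw [hW0 z H']
      exact hzV

/-! ### Partial sums and sums of squares of a partition of unity. -/

namespace PartitionOfUnity

variable {ι X : Type*} [TopologicalSpace X] (ρ : PartitionOfUnity ι X)

/-- The sum of the members of a partition of unity that come before `i`. -/
noncomputable def partialSum [LinearOrder ι] (i : ι) (x : X) : ℝ :=
  ∑ᶠ j, if j < i then ρ j x else 0

theorem partialSum_eq_sum [LinearOrder ι] (i : ι) (x : X) :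
    ρ.partialSum i x = ∑ j ∈ ρ.finsupport x, if j < i then ρ j x else 0 := by
  refine finsum_eq_sum_of_support_subset _ fun j hj => ?_
  rw [ρ.coe_finsupport]
  intro h0
  simp [h0] at hj

theorem continuous_partialSum [LinearOrder ι] (i : ι) : Continuous (ρ.partialSum i) := by
  refine continuous_finsum (fun j => ?_) (ρ.locallyFinite.subset fun j x hx => ?_)
  · split_ifs
    · exact (ρ j).continuous
    · exact continuous_const
  · intro h0
    simp [h0] at hx

theorem partialSum_nonneg [LinearOrder ι] (i : ι) (x : X) : 0 ≤ ρ.partialSum i x :=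
  finsum_nonneg fun j => by split_ifs <;> simp [ρ.nonneg]

theorem partialSum_add_eq [LinearOrder ι] (i : ι) (x : X) :
    ρ.partialSum i x + ρ i x = ∑ j ∈ ρ.finsupport x, if j ≤ i then ρ j x else 0 := by
  have h1 : ρ i x = ∑ j ∈ ρ.finsupport x, if j = i then ρ j x else 0 := by
    rw [Finset.sum_ite_eq' (ρ.finsupport x) i fun j => ρ j x]
    split_ifs with h
    · rfl
    · simpa using h
  rw [partialSum_eq_sum, h1, ← Finset.sum_add_distrib]
  refine Finset.sum_congr rfl fun j _ => ?_
  rcases lt_trichotomy j i with h | h | h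
  · simp [h, h.ne, h.le]
  · simp [h]
  · simp [h.not_gt, h.ne', h.not_ge]

theorem partialSum_add_le [LinearOrder ι] {i k : ι} (h : i < k) (x : X) :
    ρ.partialSum i x + ρ i x ≤ ρ.partialSum k x := by
  rw [partialSum_add_eq, partialSum_eq_sum]
  refine Finset.sum_le_sum fun j _ => ?_
  by_cases hj : j ≤ i
  · simp [hj, hj.trans_lt h]
  · simp only [hj, if_false]
    split_ifs <;> simp [ρ.nonneg]

theorem partialSum_add_le_one [LinearOrder ι] (i : ι) (x : X) :
    ρ.partialSum i x + ρ i x ≤ 1 := by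
  rw [partialSum_add_eq, ← ρ.sum_finsupport (mem_univ x)]
  refine Finset.sum_le_sum fun j _ => ?_
  split_ifs <;> simp [ρ.nonneg]

/-- The sum of the squares of the members of a partition of unity. -/
noncomputable def sumSq (x : X) : ℝ := ∑ᶠ j, ρ j x ^ 2

theorem continuous_sumSq : Continuous ρ.sumSq :=
  continuous_finsum (fun j => (ρ j).continuous.pow 2) (ρ.locallyFinite.subset fun j x hx h0 => by
    simp [h0] at hx)

theorem sumSq_eq_sum (x : X) : ρ.sumSq x = ∑ j ∈ ρ.finsupport x, ρ j x ^ 2 := by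
  refine finsum_eq_sum_of_support_subset _ fun j hj => ?_
  rw [ρ.coe_finsupport]
  intro h0
  simp [h0] at hj

theorem sumSq_pos (x : X) : 0 < ρ.sumSq x := by
  obtain ⟨i, hi⟩ := ρ.exists_pos (mem_univ x)
  rw [sumSq_eq_sum]
  exact Finset.sum_pos' (fun j _ => sq_nonneg _) ⟨i, by simpa using hi.ne', by positivity⟩

/-- The sum of squares is the mean of the `ρ i x` with weights `ρ i x`, so some member is at least
as large. It serves as a continuous positive lower bound for the maximum. -/
theorem exists_sumSq_le (x : X) : ∃ i, ρ.sumSq x ≤ ρ i x := by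
  by_contra! H
  have h1 : ∑ j ∈ ρ.finsupport x, ρ j x ^ 2 < ∑ j ∈ ρ.finsupport x, ρ j x * ρ.sumSq x := by
    obtain ⟨i, hi⟩ := ρ.exists_pos (mem_univ x)
    refine Finset.sum_lt_sum (fun j _ => ?_) ⟨i, by simpa using hi.ne', ?_⟩
    · rw [sq]
      exact mul_le_mul_of_nonneg_left (H j).le (ρ.nonneg j x)
    · rw [sq]
      exact mul_lt_mul_of_pos_left (H i) hi
  rw [← Finset.sum_mul, ρ.sum_finsupport (mem_univ x), one_mul, ← sumSq_eq_sum] at h1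
  exact lt_irrefl _ h1

end PartitionOfUnity

/-! ### The family of paths through the basepoint. -/

theorem exists_paths_through {X : Type u} [TopologicalSpace X] [PathConnectedSpace X]
    (hX : HasNumerableCategory X) (x₀ : X) :
    ∃ W : X × I → X, Continuous W ∧ (∀ x, W (x, 0) = x) ∧ ∀ x, ∃ t, W (x, t) = x₀ := by
  classical
  obtain ⟨ι, U, hU, hnull, ρ, hρ⟩ := hX
  let : LinearOrder ι := linearOrderOfSTO (WellOrderingRel (α := ι))
  choose γ hγ hγ0 hγ1 using fun i => exists_contraction_of_nullhomotopic x₀ (hnull i)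
  -- A tent over the `i`-th interval: its peak is `ρ i x / sumSq x`, which is at least `1` for some
  -- `i`.
  let m : ι → X × I → ℝ := fun i y =>
    2 / ρ.sumSq y.1 * min (y.2 - ρ.partialSum i y.1) (ρ.partialSum i y.1 + ρ i y.1 - y.2)
  have hm : ∀ i, Continuous (m i) := by
    intro i
    have h1 := ρ.continuous_partialSum i
    have h2 := ρ.continuous_sumSq
    have h3 : Continuous fun y : X × I => 2 / ρ.sumSq y.1 :=
      continuous_const.div (h2.comp continuous_fst) fun y => (ρ.sumSq_pos y.1).ne'
    fun_prop
  let h : ι → X × I → I := fun i y => projIcc 0 1 zero_le_one (m i y)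
  have hne : ∀ i y, h i y ≠ 0 →
      ρ.partialSum i y.1 < y.2 ∧ (y.2 : ℝ) < ρ.partialSum i y.1 + ρ i y.1 := by
    intro i y hy
    have hpos : 0 < m i y := by
      by_contra! H
      exact hy (projIcc_of_le_left _ H)
    have := (mul_pos_iff_of_pos_left (div_pos two_pos (ρ.sumSq_pos y.1))).1 hpos
    rw [lt_min_iff] at this
    constructor <;> linarith [this.1, this.2]
  have hsupp : ∀ i y, h i y ≠ 0 → ρ i y.1 ≠ 0 := by
    intro i y hy h0
    have := hne i y hy
    linarith [this.1, this.2]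
  obtain ⟨W, hWc, hW0, hW1⟩ := exists_continuous_glue (q := Prod.fst) (h := h) (U := U) (γ := γ)
    continuous_fst (fun i => continuous_projIcc.comp (hm i))
    ((ρ.locallyFinite.preimage_continuous continuous_fst).subset fun i y hy => hsupp i y hy) hU
    (fun i y hy => hρ i (by
      have := (continuous_fst (X := X) (Y := I)).closure_preimage_subset (Function.support (ρ i))
      exact this (closure_mono (fun z hz => hsupp i z hz) hy)))
    (fun i j y hi hj => by
      have h1 := hne i y hi
      have h2 := hne j y hj
      rcases lt_trichotomy i j with hij | hij | hij
      · linarith [ρ.partialSum_add_le hij y.1, h1.2, h2.1]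
      · exact hij
      · linarith [ρ.partialSum_add_le hij y.1, h2.2, h1.1]) hγ hγ0
  refine ⟨W, hWc, fun x => hW0 _ fun i => ?_, fun x => ?_⟩
  · by_contra H
    have := (hne i _ H).1
    simp only [Icc.coe_zero] at this
    linarith [ρ.partialSum_nonneg i x]
  · obtain ⟨i, hi⟩ := ρ.exists_sumSq_le x
    have hQ := ρ.sumSq_pos x
    have hT := ρ.partialSum_nonneg i x
    have hT1 := ρ.partialSum_add_le_one i x
    let t : I := ⟨ρ.partialSum i x + ρ i x / 2, by constructor <;> linarith⟩
    have ht : h i (x, t) = 1 := by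
      apply projIcc_of_right_le
      have : min ((t : ℝ) - ρ.partialSum i x) (ρ.partialSum i x + ρ i x - t) = ρ i x / 2 := by
        have h1 : (t : ℝ) - ρ.partialSum i x = ρ i x / 2 := by simp [t]
        have h2 : ρ.partialSum i x + ρ i x - t = ρ i x / 2 := by simp only [t]; ring
        rw [h1, h2, min_self]
      simp only [m, this]
      rw [div_mul_div_comm, one_le_div (by positivity)]
      linarith
    have hx : x ∈ U i := hρ i (subset_closure (show ρ i x ≠ 0 by linarith))
    refine ⟨t, ?_⟩
    rw [hW1 i (x, t) (by rw [ht]; exact one_ne_zero), ht]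
    exact hγ1 i x hx

/-! ### Collapsing a hemisphere of the unit sphere. -/

section SphereSquash

variable {E : Type*} [NormedAddCommGroup E] [InnerProductSpace ℝ E]

/-- The nonnegative root `s` of `s ^ 2 - 2 * t * u * s + t ^ 2 - 1`. -/
noncomputable def squashCoeff (t u : ℝ) : ℝ := t * u + √(t ^ 2 * u ^ 2 + 1 - t ^ 2)

theorem squashCoeff_quadratic {t u : ℝ} (ht : t ^ 2 ≤ 1) :
    squashCoeff t u ^ 2 - 2 * t * u * squashCoeff t u + t ^ 2 = 1 := by
  have h : 0 ≤ t ^ 2 * u ^ 2 + 1 - t ^ 2 := by nlinarith [mul_nonneg (sq_nonneg t) (sq_nonneg u)]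
  have := Real.sq_sqrt h
  simp only [squashCoeff]
  nlinarith

/-- The roots are symmetric about `t * u`, so this inequality selects the larger one. -/
theorem squashCoeff_eq {t u s : ℝ} (hs : s ^ 2 - 2 * t * u * s + t ^ 2 = 1) (h : t * u ≤ s) :
    squashCoeff t u = s := by
  have : t ^ 2 * u ^ 2 + 1 - t ^ 2 = (s - t * u) ^ 2 := by linarith
  rw [squashCoeff, this, Real.sqrt_sq (by linarith)]
  ring

theorem squashCoeff_zero (u : ℝ) : squashCoeff 0 u = 1 := by simp [squashCoeff]

theorem squashCoeff_one_of_nonpos {u : ℝ} (hu : u ≤ 0) : squashCoeff 1 u = 0 :=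
  squashCoeff_eq (by ring) (by linarith)

/-- The vector obtained from `p` by moving it along the great circles through `e` towards `-e`;
at time `t = 1` the hemisphere opposite to `e` is collapsed to `-e`. -/
noncomputable def squashVec (e : E) (t : ℝ) (p : E) : E :=
  squashCoeff t (inner ℝ p e) • p - t • e

theorem norm_squashVec {e p : E} (he : ‖e‖ = 1) (hp : ‖p‖ = 1) {t : ℝ} (ht : t ^ 2 ≤ 1) :
    ‖squashVec e t p‖ = 1 := by
  rw [← sq_eq_sq₀ (norm_nonneg _) zero_le_one, squashVec, norm_sub_sq_real, norm_smul, norm_smul,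
    inner_smul_left, inner_smul_right, hp, he, mul_one, mul_one, Real.norm_eq_abs,
    Real.norm_eq_abs, sq_abs, sq_abs, one_pow]
  have := squashCoeff_quadratic ht (u := inner ℝ p e)
  simp only [conj_trivial]
  linarith

theorem squashVec_zero (e p : E) : squashVec e 0 p = p := by
  simp [squashVec, squashCoeff_zero]

theorem squashVec_one {e p : E} (h : inner ℝ p e ≤ 0) : squashVec e 1 p = -e := by
  simp [squashVec, squashCoeff_one_of_nonpos h]

/-- Solving `s • p - t • e = q` gives `s • p = q + t • e`, so `s` should be the norm of the right
side. It is the larger root because `0 ≤ 1 + t * c`. -/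
theorem squashVec_normalize {e q : E} (he : ‖e‖ = 1) (hq : ‖q‖ = 1) {t : ℝ} (ht0 : 0 ≤ t)
    (ht1 : t ≤ 1) (h : q + t • e ≠ 0) : squashVec e t (‖q + t • e‖⁻¹ • (q + t • e)) = q := by
  set N := ‖q + t • e‖ with hN
  have hN0 : 0 < N := norm_pos_iff.2 h
  set c := inner ℝ q e with hc
  have hcle : -1 ≤ c := by
    have := abs_real_inner_le_norm q e
    rw [hq, he, one_mul] at this
    exact (abs_le.1 this).1
  have hNsq : N ^ 2 = 1 + 2 * t * c + t ^ 2 := by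
    rw [hN, norm_add_sq_real, hq, norm_smul, he, inner_smul_right, Real.norm_eq_abs, mul_one,
      sq_abs]
    ring
  have hinner : inner ℝ (N⁻¹ • (q + t • e)) e = N⁻¹ * (c + t) := by
    rw [inner_smul_left, inner_add_left, inner_smul_left, real_inner_self_eq_norm_sq, he]
    simp [hc]
  have hcoeff : squashCoeff t (N⁻¹ * (c + t)) = N := by
    refine squashCoeff_eq ?_ ?_
    · have : 2 * t * (N⁻¹ * (c + t)) * N = 2 * t * (c + t) := by field_simp
      rw [this, hNsq]
      ring
    · rw [← mul_assoc, mul_comm t, mul_assoc, inv_mul_le_iff₀ hN0]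
      nlinarith
  rw [squashVec, hinner, hcoeff, smul_smul, mul_inv_cancel₀ hN0.ne', one_smul]
  simp

theorem continuous_squashVec (e : E) : Continuous fun q : ℝ × E => squashVec e q.1 q.2 := by
  unfold squashVec squashCoeff
  fun_prop

variable (e : Metric.sphere (0 : E) 1)

/-- The homotopy of the unit sphere that collapses the hemisphere opposite to `e`. -/
noncomputable def sphereSquash (q : I × Metric.sphere (0 : E) 1) : Metric.sphere (0 : E) 1 :=
  ⟨squashVec (e : E) q.1 q.2, by
    rw [mem_sphere_zero_iff_norm]
    exact norm_squashVec (by simp) (by simp) (by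
      have := q.1.2.1
      have := q.1.2.2
      nlinarith)⟩

theorem continuous_sphereSquash : Continuous (sphereSquash e) := by
  have h : Continuous fun q : I × Metric.sphere (0 : E) 1 => ((q.1 : ℝ), (q.2 : E)) := by fun_prop
  exact ((continuous_squashVec (e : E)).comp h).subtype_mk _

theorem sphereSquash_zero (p : Metric.sphere (0 : E) 1) : sphereSquash e (0, p) = p :=
  Subtype.ext (by simp [sphereSquash, squashVec_zero])

theorem sphereSquash_one {p : Metric.sphere (0 : E) 1} (h : inner ℝ (p : E) (e : E) ≤ 0) :
    sphereSquash e (1, p) = -e :=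
  Subtype.ext (by simp [sphereSquash, squashVec_one h])

/-- Surjectivity at every time keeps all values of `f`. At `t = 1` the preimage must avoid the open
hemisphere on which the path is later traced; the one exceptional case, `q = -e`, is served by an
equatorial point. -/
theorem exists_sphereSquash_eq (hperp : ∃ p : Metric.sphere (0 : E) 1, inner ℝ (p : E) (e : E) = 0)
    (t : I) (q : Metric.sphere (0 : E) 1) :
    ∃ p, sphereSquash e (t, p) = q ∧ (t = 1 → 0 ≤ inner ℝ (p : E) (e : E)) := by
  have he : ‖(e : E)‖ = 1 := by simp
  have hq : ‖(q : E)‖ = 1 := by simp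
  by_cases h : (q : E) + (t : ℝ) • (e : E) = 0
  · have hqe : (q : E) = -((t : ℝ) • (e : E)) := eq_neg_of_add_eq_zero_left h
    have ht : t = 1 := by
      rw [hqe, norm_neg, norm_smul, he, mul_one, Real.norm_eq_abs, abs_of_nonneg t.2.1] at hq
      exact Subtype.ext hq
    subst ht
    obtain ⟨p, hp⟩ := hperp
    refine ⟨p, ?_, fun _ => hp.ge⟩
    rw [sphereSquash_one e hp.le]
    exact Subtype.ext (by simp [hqe])
  · refine ⟨⟨_, mem_sphere_zero_iff_norm.2 (norm_smul_inv_norm (𝕜 := ℝ) h)⟩,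
      Subtype.ext (squashVec_normalize he hq t.2.1 t.2.2 h), ?_⟩
    rintro rfl
    have := abs_real_inner_le_norm (q : E) (e : E)
    rw [hq, he, one_mul] at this
    simp only [inner_smul_left, inner_add_left, Icc.coe_one, one_smul,
      real_inner_self_eq_norm_sq, he]
    have h1 := (abs_le.1 this).1
    have h2 : (0 : ℝ) ≤ inner ℝ (q : E) (e : E) + 1 ^ 2 := by linarith
    exact mul_nonneg (by simp) h2

theorem exists_inner_eq (hperp : ∃ p : Metric.sphere (0 : E) 1, inner ℝ (p : E) (e : E) = 0)
    (t : I) : ∃ p : Metric.sphere (0 : E) 1, inner ℝ (p : E) (e : E) = -(t : ℝ) := by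
  obtain ⟨w, hw⟩ := hperp
  have he : ‖(e : E)‖ = 1 := by simp
  have hw1 : ‖(w : E)‖ = 1 := by simp
  have ht : 0 ≤ 1 - (t : ℝ) ^ 2 := by nlinarith [t.2.1, t.2.2]
  refine ⟨⟨√(1 - (t : ℝ) ^ 2) • (w : E) - (t : ℝ) • (e : E), ?_⟩, ?_⟩
  · rw [mem_sphere_zero_iff_norm, ← sq_eq_sq₀ (norm_nonneg _) zero_le_one, norm_sub_sq_real,
      norm_smul, norm_smul, inner_smul_left, inner_smul_right, hw, he, hw1, Real.norm_eq_abs,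
      Real.norm_eq_abs, mul_one, mul_one, sq_abs, sq_abs, Real.sq_sqrt ht]
    simp
  · simp only [inner_sub_left, inner_smul_left, hw, real_inner_self_eq_norm_sq, he]
    simp

end SphereSquash

/-! ### Deforming the mapping space. -/

theorem isHomotopyEquivalence_of_deformation {B : Type*} [TopologicalSpace B] {A : Set B}
    {H : I × B → B} (hc : Continuous H) (h0 : ∀ b, H (0, b) = b) (h1 : ∀ b, H (1, b) ∈ A)
    (hA : ∀ s, ∀ b ∈ A, H (s, b) ∈ A) :
    IsHomotopyEquivalence (⟨Subtype.val, continuous_subtype_val⟩ : C(A, B)) := by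
  refine ⟨⟨fun b => ⟨H (1, b), h1 b⟩, by fun_prop⟩, ?_, ?_⟩
  · refine ContinuousMap.Homotopic.symm ⟨?_⟩
    exact
      { toFun := fun q => ⟨H (q.1, q.2), hA _ _ q.2.2⟩
        continuous_toFun := by fun_prop
        map_zero_left := fun b => Subtype.ext (h0 b)
        map_one_left := fun b => rfl }
  · refine ContinuousMap.Homotopic.symm ⟨?_⟩
    exact
      { toFun := H
        continuous_toFun := hc
        map_zero_left := fun b => h0 b
        map_one_left := fun b => rfl }

theorem isHomotopyEquivalence_mapsThroughInclusion {n : ℕ} (hn : 1 ≤ n) {X : Type u}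
    [TopologicalSpace X] [PathConnectedSpace X] (hX : HasNumerableCategory X) (x₀ : X) :
    IsHomotopyEquivalence (mapsThroughInclusion n x₀) := by
  obtain ⟨W, hW, hW0, hW1⟩ := exists_paths_through hX x₀
  let e : UnitSphere n := ⟨EuclideanSpace.single 0 1, by simp⟩
  have hperp : ∃ p : UnitSphere n,
      inner ℝ (p : EuclideanSpace ℝ (Fin (n + 1))) (e : EuclideanSpace ℝ (Fin (n + 1))) = 0 := by
    refine ⟨⟨EuclideanSpace.single (Fin.last n) 1, by simp⟩, ?_⟩
    have : Fin.last n ≠ 0 := by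
      rw [Ne, Fin.ext_iff]
      simp
      omega
    simp [e, EuclideanSpace.inner_single_left, this]
  let ψ : UnitSphere n → ℝ := fun p =>
    -inner ℝ (p : EuclideanSpace ℝ (Fin (n + 1))) (e : EuclideanSpace ℝ (Fin (n + 1)))
  have hψ : Continuous ψ := by fun_prop
  -- The clamped times make the squash run during the first half and the path tracing during the
  -- second. On the hemisphere of `e`, `ψ ≤ 0` switches the tracing off.
  let K : (I × C(UnitSphere n, X)) × UnitSphere n → X := fun y =>
    W (y.1.2 (sphereSquash e (projIcc 0 1 zero_le_one (2 * (y.1.1 : ℝ)), y.2)),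
      projIcc 0 1 zero_le_one (min (2 * (y.1.1 : ℝ) - 1) (ψ y.2)))
  have hK : Continuous K := by
    have := continuous_sphereSquash e
    have h2 : Continuous (projIcc (0 : ℝ) 1 zero_le_one) := continuous_projIcc
    fun_prop
  let H : I × C(UnitSphere n, X) → C(UnitSphere n, X) := fun y =>
    ⟨fun p => K (y, p), by fun_prop⟩
  have hH : Continuous H := ContinuousMap.continuous_of_continuous_uncurry _ hK
  refine isHomotopyEquivalence_of_deformation hH (fun f => ?_) (fun f => ?_) (fun s f hf => ?_)
  · ext p
    have h1 : projIcc (0 : ℝ) 1 zero_le_one (2 * ((0 : I) : ℝ)) = 0 :=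
      projIcc_of_le_left _ (by simp)
    have h2 : projIcc (0 : ℝ) 1 zero_le_one (min (2 * ((0 : I) : ℝ) - 1) (ψ p)) = 0 :=
      projIcc_of_le_left _ (by simp)
    simp only [H, K, ContinuousMap.coe_mk, h1, h2, hW0, sphereSquash_zero]
  · obtain ⟨t, ht⟩ := hW1 (f (-e))
    obtain ⟨p, hp⟩ := exists_inner_eq e hperp t
    refine ⟨p, ?_⟩
    have h1 : projIcc (0 : ℝ) 1 zero_le_one (2 * ((1 : I) : ℝ)) = 1 :=
      projIcc_of_right_le _ (by simp)
    have h2 : min (2 * ((1 : I) : ℝ) - 1) (ψ p) = t := by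
      simp only [ψ, hp, neg_neg, Icc.coe_one]
      exact min_eq_right (by linarith [t.2.2])
    simp only [H, K, ContinuousMap.coe_mk, h1, h2, projIcc_val,
      sphereSquash_one e (hp.le.trans (neg_nonpos.2 t.2.1)), ht]
  · obtain ⟨q, hq⟩ := hf
    obtain ⟨p, hp, hp'⟩ := exists_sphereSquash_eq e hperp
      (projIcc 0 1 zero_le_one (2 * (s : ℝ))) q
    refine ⟨p, ?_⟩
    have : projIcc (0 : ℝ) 1 zero_le_one (min (2 * (s : ℝ) - 1) (ψ p)) = 0 := by
      refine projIcc_of_le_left _ ?_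
      by_cases hs : 2 * (s : ℝ) ≤ 1
      · exact (min_le_left _ _).trans (by linarith)
      · exact (min_le_right _ _).trans (neg_nonpos.2 (hp' (projIcc_of_right_le _ (by linarith))))
    simp only [H, K, ContinuousMap.coe_mk, this, hp, hW0, hq]

/-! ### Cell coordinates, heights and the radial flow. -/

section CWCoordinates

open Topology.CWComplex Metric

variable {X : Type u} [TopologicalSpace X] [Topology.CWComplex (univ : Set X)]

theorem exists_map_ball_eq (x : X) :
    ∃ c : Σ n, cell (univ : Set X) n × (Fin n → ℝ), c.2.2 ∈ ball 0 1 ∧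
      map c.1 c.2.1 c.2.2 = x := by
  have hx : x ∈ ⋃ (n : ℕ) (j : cell (univ : Set X) n), openCell n j := by
    rw [iUnion_openCell_eq_complex]
    exact mem_univ x
  simp only [mem_iUnion] at hx
  obtain ⟨n, j, v, hv, hx⟩ := hx
  exact ⟨⟨n, j, v⟩, hv, hx⟩

/-- The open cell containing `x`, together with the coordinates of `x` in it. -/
noncomputable def cwCoord (x : X) : Σ n, cell (univ : Set X) n × (Fin n → ℝ) :=
  (exists_map_ball_eq x).choose

theorem cwCoord_mem_ball (x : X) : (cwCoord x).2.2 ∈ ball 0 1 :=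
  (exists_map_ball_eq x).choose_spec.1

theorem map_cwCoord (x : X) : map (cwCoord x).1 (cwCoord x).2.1 (cwCoord x).2.2 = x :=
  (exists_map_ball_eq x).choose_spec.2

theorem cwCoord_map {n : ℕ} (j : cell (univ : Set X) n) {v : Fin n → ℝ} (hv : v ∈ ball 0 1) :
    cwCoord (map n j v) = ⟨n, j, v⟩ := by
  have h1 := cwCoord_mem_ball (map n j v)
  have h2 := map_cwCoord (map n j v)
  generalize cwCoord (map n j v) = c at h1 h2
  obtain ⟨m, i, w⟩ := c
  have h3 : (⟨m, i⟩ : Σ n, cell (univ : Set X) n) = ⟨n, j⟩ := by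
    refine eq_of_not_disjoint_openCell (not_disjoint_iff.2 ⟨map n j v, ?_, ?_⟩)
    · exact ⟨w, h1, h2⟩
    · exact ⟨v, hv, rfl⟩
  obtain rfl : m = n := congrArg Sigma.fst h3
  obtain rfl : i = j := by simpa using h3
  have h4 : w = v := (map m i).injOn (by rwa [source_eq]) (by rwa [source_eq]) h2
  rw [h4]

/-- The dimension of the open cell containing `x`. -/
noncomputable def cwDim (x : X) : ℕ := (cwCoord x).1

/-- The distance of `x` from the centre of its open cell. -/
noncomputable def cwRadius (x : X) : ℝ := ‖(cwCoord x).2.2‖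

/-- The image of `x` under the dilation by `l` of its cell. -/
noncomputable def cwRay (x : X) (l : ℝ) : X :=
  map (cwCoord x).1 (cwCoord x).2.1 (l • (cwCoord x).2.2)

theorem cwDim_map {n : ℕ} (j : cell (univ : Set X) n) {v : Fin n → ℝ} (hv : v ∈ ball 0 1) :
    cwDim (map n j v) = n := by rw [cwDim, cwCoord_map j hv]

theorem cwRadius_map {n : ℕ} (j : cell (univ : Set X) n) {v : Fin n → ℝ} (hv : v ∈ ball 0 1) :
    cwRadius (map n j v) = ‖v‖ := by rw [cwRadius, cwCoord_map j hv]

theorem cwRay_map {n : ℕ} (j : cell (univ : Set X) n) {v : Fin n → ℝ} (hv : v ∈ ball 0 1)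
    (l : ℝ) : cwRay (map n j v) l = map n j (l • v) := by
  rw [cwRay, cwCoord_map j hv]

theorem cwRadius_nonneg (x : X) : 0 ≤ cwRadius x := norm_nonneg _

theorem cwRadius_lt_one (x : X) : cwRadius x < 1 := by
  simpa [cwRadius] using cwCoord_mem_ball x

theorem cwRay_one (x : X) : cwRay x 1 = x := by rw [cwRay, one_smul, map_cwCoord]

theorem mem_openCell_cwCoord (x : X) : x ∈ openCell (cwCoord x).1 (cwCoord x).2.1 :=
  ⟨_, cwCoord_mem_ball x, map_cwCoord x⟩

theorem cwDim_eq_of_mem_openCell {n : ℕ} {j : cell (univ : Set X) n} {x : X}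
    (hx : x ∈ openCell n j) : cwDim x = n := by
  obtain ⟨v, hv, rfl⟩ := hx
  exact cwDim_map j hv

theorem cwDim_lt_of_mem_cellFrontier {n : ℕ} {j : cell (univ : Set X) n} {x : X}
    (hx : x ∈ cellFrontier n j) : cwDim x < n := by
  obtain ⟨s, hs⟩ := cellFrontier_subset_finite_openCell n j
  have := hs hx
  simp only [mem_iUnion] at this
  obtain ⟨m, hm, i, -, hi⟩ := this
  rwa [cwDim_eq_of_mem_openCell hi]

theorem cwDim_le_of_mem_closedCell {n : ℕ} {j : cell (univ : Set X) n} {x : X}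
    (hx : x ∈ closedCell n j) : cwDim x ≤ n := by
  rw [← cellFrontier_union_openCell_eq_closedCell] at hx
  rcases hx with hx | hx
  · exact (cwDim_lt_of_mem_cellFrontier hx).le
  · exact (cwDim_eq_of_mem_openCell hx).le

/-- The radial projection of `x` to the boundary of its cell. -/
noncomputable def cwBoundary (x : X) : X := cwRay x (cwRadius x)⁻¹

theorem cwDim_cwBoundary_lt {x : X} (hx : cwRadius x ≠ 0) : cwDim (cwBoundary x) < cwDim x := by
  refine cwDim_lt_of_mem_cellFrontier (j := (cwCoord x).2.1) ⟨_, ?_, rfl⟩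
  rw [mem_sphere_zero_iff_norm]
  exact norm_smul_inv_norm (𝕜 := ℝ) (by rwa [cwRadius, norm_ne_zero_iff] at hx)

theorem cwBoundary_map {n : ℕ} (j : cell (univ : Set X) n) {v : Fin n → ℝ} (hv : v ∈ ball 0 1) :
    cwBoundary (map n j v) = map n j (‖v‖⁻¹ • v) := by
  rw [cwBoundary, cwRadius_map j hv, cwRay_map j hv]

/-- The inverse of the dilation factor after which the radial flow takes `x` into the union of
the cells of dimension less than `k`, and `0` if this never happens. -/
noncomputable def cwHeight (k : ℕ) (x : X) : ℝ :=
  open scoped Classical in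
  if cwDim x < k then 1 else if _h : cwRadius x = 0 then 0 else
    cwRadius x * cwHeight k (cwBoundary x)
termination_by cwDim x
decreasing_by exact cwDim_cwBoundary_lt _h

theorem cwHeight_of_lt {k : ℕ} {x : X} (h : cwDim x < k) : cwHeight k x = 1 := by
  rw [cwHeight, if_pos h]

theorem cwHeight_of_le {k : ℕ} {x : X} (h : k ≤ cwDim x) :
    cwHeight k x = cwRadius x * cwHeight k (cwBoundary x) := by
  rw [cwHeight, if_neg h.not_gt]
  split_ifs with h0
  · rw [h0, zero_mul]
  · rfl

theorem cw_induction {p : X → Prop}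
    (h : ∀ x, (cwRadius x ≠ 0 → p (cwBoundary x)) → p x) (x : X) : p x := by
  induction hd : cwDim x using Nat.strong_induction_on generalizing x with
  | _ d ih =>
    subst hd
    exact h x fun hx => ih _ (cwDim_cwBoundary_lt hx) _ rfl

theorem cwHeight_mem_Icc (k : ℕ) (x : X) : cwHeight k x ∈ Icc (0 : ℝ) 1 := by
  induction x using cw_induction with
  | h x ih =>
    rcases lt_or_ge (cwDim x) k with h | h
    · simp [cwHeight_of_lt h]
    · rw [cwHeight_of_le h]
      by_cases h0 : cwRadius x = 0
      · simp [h0]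
      · obtain ⟨h1, h2⟩ := ih h0
        exact ⟨mul_nonneg (cwRadius_nonneg x) h1, mul_le_one₀ (cwRadius_lt_one x).le h1 h2⟩

theorem cwHeight_mono {k l : ℕ} (hkl : k ≤ l) (x : X) : cwHeight k x ≤ cwHeight l x := by
  induction x using cw_induction with
  | h x ih =>
    rcases lt_or_ge (cwDim x) l with h | h
    · rw [cwHeight_of_lt h]
      exact (cwHeight_mem_Icc k x).2
    · rw [cwHeight_of_le h, cwHeight_of_le (hkl.trans h)]
      by_cases h0 : cwRadius x = 0
      · simp [h0]
      · exact mul_le_mul_of_nonneg_left (ih h0) (cwRadius_nonneg x)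

theorem cwHeight_zero (x : X) : cwHeight 0 x = 0 := by
  induction x using cw_induction with
  | h x ih =>
    rw [cwHeight_of_le (Nat.zero_le _)]
    by_cases h0 : cwRadius x = 0
    · simp [h0]
    · simp [ih h0]

/-- Trivial for `‖v‖ = 1`, so the recursion holds on the whole closed ball; this reduces continuity
on a cell to its frontier. -/
theorem cwHeight_map {k n : ℕ} (hk : k ≤ n) (j : cell (univ : Set X) n) {v : Fin n → ℝ}
    (hv : v ∈ closedBall 0 1) :
    cwHeight k (map n j v) = ‖v‖ * cwHeight k (map n j (‖v‖⁻¹ • v)) := by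
  rw [mem_closedBall_zero_iff] at hv
  rcases hv.lt_or_eq with h | h
  · have hv' : v ∈ ball 0 1 := by simpa using h
    rw [cwHeight_of_le (by rwa [cwDim_map j hv']), cwRadius_map j hv', cwBoundary_map j hv']
  · simp [h]

/-- The radial flow of a CW complex, parametrised by the dilation factor: points move away from
the centre of their cell, and once they reach the boundary they move on in a lower cell. -/
noncomputable def cwFlow (x : X) (l : ℝ) : X :=
  open scoped Classical in
  if _h : l * cwRadius x ≤ 1 then cwRay x l else cwFlow (cwBoundary x) (l * cwRadius x)
termination_by cwDim x
decreasing_by exact cwDim_cwBoundary_lt fun h0 => _h (by simp [h0])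

theorem cwFlow_of_le {x : X} {l : ℝ} (h : l * cwRadius x ≤ 1) : cwFlow x l = cwRay x l := by
  rw [cwFlow, dif_pos h]

theorem cwFlow_one (x : X) : cwFlow x 1 = x := by
  rw [cwFlow_of_le (by linarith [cwRadius_lt_one x]), cwRay_one]

theorem cwFlow_of_ge {x : X} {l : ℝ} (h : 1 ≤ l * cwRadius x) :
    cwFlow x l = cwFlow (cwBoundary x) (l * cwRadius x) := by
  rcases h.lt_or_eq with h | h
  · rw [cwFlow, dif_neg h.not_ge]
  · rw [cwFlow_of_le h.ge, ← h, cwFlow_one, cwBoundary, eq_inv_of_mul_eq_one_left h.symm]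

theorem cwFlow_map_of_le {n : ℕ} (j : cell (univ : Set X) n) {v : Fin n → ℝ}
    (hv : v ∈ closedBall 0 1) {l : ℝ} (hl : 1 ≤ l) (h : l * ‖v‖ ≤ 1) :
    cwFlow (map n j v) l = map n j (l • v) := by
  rw [mem_closedBall_zero_iff] at hv
  rcases hv.lt_or_eq with h1 | h1
  · have hv' : v ∈ ball 0 1 := by simpa using h1
    rw [cwFlow_of_le (by rwa [cwRadius_map j hv']), cwRay_map j hv']
  · obtain rfl : l = 1 := le_antisymm (by simpa [h1] using h) hl
    rw [cwFlow_one, one_smul]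

theorem cwFlow_map_of_ge {n : ℕ} (j : cell (univ : Set X) n) {v : Fin n → ℝ}
    (hv : v ∈ closedBall 0 1) {l : ℝ} (h : 1 ≤ l * ‖v‖) :
    cwFlow (map n j v) l = cwFlow (map n j (‖v‖⁻¹ • v)) (l * ‖v‖) := by
  rw [mem_closedBall_zero_iff] at hv
  rcases hv.lt_or_eq with h1 | h1
  · have hv' : v ∈ ball 0 1 := by simpa using h1
    rw [cwFlow_of_ge (by rwa [cwRadius_map j hv']), cwBoundary_map j hv', cwRadius_map j hv']
  · simp [h1]

theorem continuous_cwFlow_max (x : X) : Continuous fun l : ℝ => cwFlow x (max 1 l) := by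
  induction x using cw_induction with
  | h x ih =>
    have hc : Continuous fun l : ℝ => max 1 l * cwRadius x := by fun_prop
    rw [← continuousOn_univ]
    have hu : (univ : Set ℝ) = {l | max 1 l * cwRadius x ≤ 1} ∪ {l | 1 ≤ max 1 l * cwRadius x} := by
      ext l
      simp [le_total]
    rw [hu]
    refine ContinuousOn.union_of_isClosed ?_ ?_ (isClosed_le hc continuous_const)
      (isClosed_le continuous_const hc)
    · have : ContinuousOn (fun l : ℝ => cwRay x (max 1 l)) {l | max 1 l * cwRadius x ≤ 1} := by
        refine (continuousOn (cwCoord x).1 (cwCoord x).2.1).comp (by fun_prop) fun l hl => ?_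
        rw [mem_closedBall_zero_iff, norm_smul, Real.norm_eq_abs,
          abs_of_nonneg (zero_le_one.trans (le_max_left _ _))]
        exact hl
      exact this.congr fun l hl => cwFlow_of_le hl
    · by_cases h0 : cwRadius x = 0
      · intro l hl
        simp [h0] at hl
        linarith
      · refine ((ih h0).comp hc).continuousOn.congr fun l hl => ?_
        simp only [Function.comp]
        rw [cwFlow_of_ge hl, max_eq_right (show 1 ≤ max 1 l * cwRadius x from hl)]

theorem one_le_inv_cwHeight {k : ℕ} {x : X} (h : cwHeight k x < cwHeight (k + 1) x) :
    1 ≤ (cwHeight (k + 1) x)⁻¹ :=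
  (one_le_inv₀ ((cwHeight_mem_Icc k x).1.trans_lt h)).2 (cwHeight_mem_Icc (k + 1) x).2

/-- Both heights scale by the same radius until the dimension is at most `k`. Strictness survives
each step and excludes dimension below `k`, where both equal `1`. -/
theorem cwDim_cwFlow {k : ℕ} {x : X} (h : cwHeight k x < cwHeight (k + 1) x) :
    cwDim (cwFlow x (cwHeight (k + 1) x)⁻¹) = k := by
  induction x using cw_induction with
  | h x ih =>
    rcases lt_or_ge (cwDim x) (k + 1) with hk | hk
    · rw [cwHeight_of_lt hk, inv_one, cwFlow_one]
      rcases lt_or_ge (cwDim x) k with hk' | hk'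
      · rw [cwHeight_of_lt hk', cwHeight_of_lt hk] at h
        exact absurd h (lt_irrefl _)
      · omega
    · have e1 := cwHeight_of_le hk
      rw [e1, cwHeight_of_le ((Nat.le_succ k).trans hk)] at h
      have h0 : cwRadius x ≠ 0 := by
        intro h0
        simp [h0] at h
      have hb := lt_of_mul_lt_mul_left h (cwRadius_nonneg x)
      have e2 : (cwHeight (k + 1) x)⁻¹ * cwRadius x = (cwHeight (k + 1) (cwBoundary x))⁻¹ := by
        rw [e1, mul_inv, mul_right_comm, inv_mul_cancel₀ h0, one_mul]
      rw [cwFlow_of_ge (by rw [e2]; exact one_le_inv_cwHeight hb), e2]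
      exact ih h0 hb

theorem cwRay_eq_map_symm {k : ℕ} {j : cell (univ : Set X) k} {x : X} (hx : x ∈ openCell k j)
    (l : ℝ) : cwRay x l = map k j (l • (map k j).symm x) := by
  obtain ⟨v, hv, rfl⟩ := hx
  rw [cwRay_map j hv, (map k j).left_inv (by rwa [source_eq])]

theorem openCell_eq_target {k : ℕ} (j : cell (univ : Set X) k) :
    openCell k j = (map k j).target := by
  rw [openCell, ← source_eq k j, (map k j).image_source_eq_target]

theorem joined_of_mem_closedCell {n : ℕ} {j : cell (univ : Set X) n} {x y : X}
    (hx : x ∈ closedCell n j) (hy : y ∈ closedCell n j) : Joined x y := by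
  have h : IsPathConnected (closedCell n j) :=
    ((convex_closedBall (0 : Fin n → ℝ) 1).isPathConnected ⟨0, by simp⟩).image'
      (continuousOn n j)
  exact (h.joinedIn x hx y hy).joined

end CWCoordinates

/-! ### Continuity by induction over cells. -/

section CWContinuity

open Topology.CWComplex Metric

variable {X : Type u} [TopologicalSpace X] [T2Space X] [Topology.CWComplex (univ : Set X)]

theorem continuousOn_closedCell {Z : Type*} [TopologicalSpace Z] {g : X → Z} {n : ℕ}
    {j : cell (univ : Set X) n} (h : ContinuousOn (g ∘ map n j) (closedBall 0 1)) :
    ContinuousOn g (closedCell n j) := by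
  rw [continuousOn_iff_isClosed]
  intro S hS
  have hc : IsClosed (closedBall 0 1 ∩ (g ∘ map n j) ⁻¹' S) :=
    h.preimage_isClosed_of_isClosed isClosed_closedBall hS
  have hcomp : IsCompact (closedBall 0 1 ∩ (g ∘ map n j) ⁻¹' S) :=
    (isCompact_closedBall 0 1).of_isClosed_subset hc inter_subset_left
  refine ⟨map n j '' (closedBall 0 1 ∩ (g ∘ map n j) ⁻¹' S),
    (hcomp.image_of_continuousOn ((continuousOn n j).mono inter_subset_left)).isClosed, ?_⟩
  ext x
  constructor
  · rintro ⟨hx, v, hv, rfl⟩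
    exact ⟨⟨v, ⟨hv, hx⟩, rfl⟩, v, hv, rfl⟩
  · rintro ⟨⟨v, ⟨hv, hx⟩, rfl⟩, -⟩
    exact ⟨hx, v, hv, rfl⟩

theorem continuous_of_cells {Z : Type*} [TopologicalSpace Z] {g : X → Z}
    (h : ∀ n (j : cell (univ : Set X) n), ContinuousOn (g ∘ map n j) (closedBall 0 1)) :
    Continuous g := by
  refine continuous_iff_isClosed.2 fun S hS => ?_
  rw [closed (univ : Set X) _ (subset_univ _)]
  intro n j
  rw [inter_comm]
  exact (continuousOn_closedCell (h n j)).preimage_isClosed_of_isClosed isClosed_closedCell hS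

/-- A cell frontier lies in finitely many closed cells of lower dimension, so induction supplies
continuity on the sphere. -/
theorem continuous_of_cells_of_frontier {Z : Type*} [TopologicalSpace Z] {g : X → Z}
    (h : ∀ n (j : cell (univ : Set X) n), ContinuousOn (g ∘ map n j) (sphere 0 1) →
      ContinuousOn (g ∘ map n j) (closedBall 0 1)) : Continuous g := by
  refine continuous_of_cells fun n => ?_
  induction n using Nat.strong_induction_on with
  | _ n ih =>
    intro j
    refine h n j ?_
    obtain ⟨s, hs⟩ := cellFrontier_subset_finite_closedCell n j
    have hU : ContinuousOn g (⋃ q : Σ m : Fin n, s m, closedCell q.1.1 q.2.1) :=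
      (locallyFinite_of_finite _).continuousOn_iUnion (fun _ => isClosed_closedCell)
        fun q => continuousOn_closedCell (ih q.1.1 q.1.2 q.2.1)
    refine hU.comp ((continuousOn n j).mono sphere_subset_closedBall) fun v hv => ?_
    have := hs ⟨v, hv, rfl⟩
    simp only [mem_iUnion] at this ⊢
    obtain ⟨m, hm, i, hi, hv'⟩ := this
    exact ⟨⟨⟨m, hm⟩, i, hi⟩, hv'⟩

theorem continuousOn_normalize {E : Type*} [NormedAddCommGroup E] [NormedSpace ℝ E] :
    ContinuousOn (fun v : E => ‖v‖⁻¹ • v) {0}ᶜ :=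
  ContinuousOn.smul (continuous_norm.continuousOn.inv₀ fun v hv => by simpa using hv)
    continuousOn_id

theorem normalize_mem_sphere {E : Type*} [NormedAddCommGroup E] [NormedSpace ℝ E] {v : E}
    (hv : v ≠ 0) : ‖v‖⁻¹ • v ∈ sphere (0 : E) 1 :=
  mem_sphere_zero_iff_norm.2 (norm_smul_inv_norm (𝕜 := ℝ) hv)

theorem continuous_cwHeight (k : ℕ) : Continuous (cwHeight k : X → ℝ) := by
  refine continuous_of_cells_of_frontier fun n j hs => ?_
  rcases lt_or_ge n k with hk | hk
  · refine (continuousOn_const (c := (1 : ℝ))).congr fun v hv => ?_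
    exact cwHeight_of_lt ((cwDim_le_of_mem_closedCell (j := j) ⟨v, hv, rfl⟩).trans_lt hk)
  · intro v hv
    by_cases h0 : v = 0
    · subst h0
      have h1 : (cwHeight k ∘ map n j) 0 = 0 := by
        simp only [Function.comp]
        rw [cwHeight_map hk j hv, norm_zero, zero_mul]
      rw [ContinuousWithinAt, h1]
      refine squeeze_zero' (g := fun v => ‖v‖) (Eventually.of_forall fun w => ?_) ?_ ?_
      · exact (cwHeight_mem_Icc k _).1
      · filter_upwards [self_mem_nhdsWithin] with w hw
        simp only [Function.comp]
        rw [cwHeight_map hk j hw]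
        exact mul_le_of_le_one_right (norm_nonneg _) (cwHeight_mem_Icc k _).2
      · exact (continuous_norm.tendsto' _ _ norm_zero).mono_left nhdsWithin_le_nhds
    · have h1 : ContinuousOn (fun w => ‖w‖ * (cwHeight k ∘ map n j) (‖w‖⁻¹ • w)) {0}ᶜ :=
        continuous_norm.continuousOn.mul
          (hs.comp continuousOn_normalize fun w hw => normalize_mem_sphere hw)
      have h2 := (h1.continuousAt (isOpen_compl_singleton.mem_nhds h0)).continuousWithinAt
        (s := closedBall 0 1)
      exact h2.congr (fun w hw => cwHeight_map hk j hw) (cwHeight_map hk j hv)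

/-- The radial flow as a map to a space of continuous maps. -/
noncomputable def cwFlowMap (x : X) : C(ℝ, X) := ⟨_, continuous_cwFlow_max x⟩

/-- Currying allows a cellwise check in `x` alone, without a cell structure on `X × ℝ`. -/
theorem continuous_cwFlowMap : Continuous (cwFlowMap : X → C(ℝ, X)) := by
  refine continuous_of_cells_of_frontier fun n j hs => ?_
  refine ContinuousMap.continuousOn_of_continuousOn_uncurry _ ?_
  have hc : Continuous fun q : (Fin n → ℝ) × ℝ => max 1 q.2 * ‖q.1‖ := by fun_prop
  have hB : IsClosed (closedBall (0 : Fin n → ℝ) 1 ×ˢ (univ : Set ℝ)) :=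
    isClosed_closedBall.prod isClosed_univ
  have hu : closedBall (0 : Fin n → ℝ) 1 ×ˢ (univ : Set ℝ) =
      closedBall 0 1 ×ˢ univ ∩ {q | max 1 q.2 * ‖q.1‖ ≤ 1} ∪
      closedBall 0 1 ×ˢ univ ∩ {q | 1 ≤ max 1 q.2 * ‖q.1‖} := by
    rw [← inter_union_distrib_left, eq_comm, inter_eq_left]
    intro q _
    exact le_total (max 1 q.2 * ‖q.1‖) 1
  rw [hu]
  refine ContinuousOn.union_of_isClosed ?_ ?_ (hB.inter (isClosed_le hc continuous_const))
    (hB.inter (isClosed_le continuous_const hc))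
  · have : ContinuousOn (fun q : (Fin n → ℝ) × ℝ => map n j (max 1 q.2 • q.1))
        (closedBall 0 1 ×ˢ univ ∩ {q | max 1 q.2 * ‖q.1‖ ≤ 1}) := by
      refine (continuousOn n j).comp (by fun_prop) fun q hq => ?_
      rw [mem_closedBall_zero_iff, norm_smul, Real.norm_eq_abs,
        abs_of_nonneg (zero_le_one.trans (le_max_left _ _))]
      exact hq.2
    exact this.congr fun q hq => cwFlow_map_of_le j hq.1.1 (le_max_left _ _) hq.2
  · have hne : ∀ q ∈ closedBall (0 : Fin n → ℝ) 1 ×ˢ (univ : Set ℝ) ∩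
        {q | 1 ≤ max 1 q.2 * ‖q.1‖}, q.1 ≠ 0 := by
      rintro q ⟨-, hq⟩ h0
      simp [h0] at hq
      linarith
    have h1 : ContinuousOn (fun q : (Fin n → ℝ) × ℝ => (cwFlowMap ∘ map n j) (‖q.1‖⁻¹ • q.1))
        (closedBall 0 1 ×ˢ univ ∩ {q | 1 ≤ max 1 q.2 * ‖q.1‖}) :=
      hs.comp (continuousOn_normalize.comp continuousOn_fst hne)
        fun q hq => normalize_mem_sphere (hne q hq)
    have h2 := continuous_eval.comp_continuousOn (h1.prodMk hc.continuousOn)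
    refine h2.congr fun q hq => ?_
    have := cwFlow_map_of_ge j hq.1.1 hq.2
    simp only [Function.comp, cwFlowMap, Function.uncurry, ContinuousMap.coe_mk]
    rw [this, max_eq_right (show 1 ≤ max 1 q.2 * ‖q.1‖ from hq.2)]

end CWContinuity

/-! ### Nullhomotopies of the strata and of their neighbourhoods. -/

section CWCategory

open Topology.CWComplex Metric

variable {X : Type u} [TopologicalSpace X] [T2Space X] [Topology.CWComplex (univ : Set X)]

/-- Removing one open `k`-cell from the `k`-skeleton leaves a union of closed cells, so open
`k`-cells are open in the `k`-th stratum. -/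
theorem isClosed_cwDim_le_diff_openCell {k : ℕ} (j : cell (univ : Set X) k) :
    IsClosed {x : X | cwDim x ≤ k ∧ x ∉ openCell k j} := by
  refine isClosed_of_disjoint_openCell_or_isClosed_inter_closedCell (subset_univ _)
    fun n _ i => ?_
  rcases lt_or_ge k n with hn | hn
  · left
    rw [disjoint_left]
    rintro x ⟨hx, -⟩ hx'
    rw [cwDim_eq_of_mem_openCell hx'] at hx
    omega
  by_cases hij : (⟨n, i⟩ : Σ n, cell (univ : Set X) n) = ⟨k, j⟩
  · left
    obtain rfl : n = k := congrArg Sigma.fst hij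
    obtain rfl : i = j := by simpa using hij
    rw [disjoint_left]
    exact fun x hx => hx.2
  · right
    have : closedCell n i ⊆ {x : X | cwDim x ≤ k ∧ x ∉ openCell k j} := by
      refine fun x hx => ⟨(cwDim_le_of_mem_closedCell hx).trans hn, fun hx' => ?_⟩
      rw [← cellFrontier_union_openCell_eq_closedCell] at hx
      rcases hx with hx | hx
      · have h1 := cwDim_lt_of_mem_cellFrontier hx
        rw [cwDim_eq_of_mem_openCell hx'] at h1
        omega
      · exact disjoint_left.1 (disjoint_openCell_of_ne hij) hx hx'
    rw [inter_eq_right.2 this]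
    exact isClosed_closedCell

theorem isOpen_openCell_in_cwDim_eq {k : ℕ} (j : cell (univ : Set X) k) :
    IsOpen {x : {x : X // cwDim x = k} | (x : X) ∈ openCell k j} := by
  have := ((isClosed_cwDim_le_diff_openCell j).preimage
    (continuous_subtype_val (p := fun x : X => cwDim x = k))).isOpen_compl
  convert this using 1
  ext x
  simp [x.2.le]

theorem continuous_of_openCells {Y Z : Type*} [TopologicalSpace Y] [TopologicalSpace Z] {k : ℕ}
    {g : Y × {x : X // cwDim x = k} → Z}
    (h : ∀ j : cell (univ : Set X) k, ContinuousOn g {q | (q.2 : X) ∈ openCell k j}) :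
    Continuous g := by
  refine continuous_iff_continuousAt.2 ?_
  rintro ⟨y, x, rfl⟩
  exact (h (cwCoord x).2.1).continuousAt
    (((isOpen_openCell_in_cwDim_eq _).preimage continuous_snd).mem_nhds (mem_openCell_cwCoord x))

theorem continuous_cwRay (k : ℕ) :
    Continuous fun q : I × {x : X // cwDim x = k} => cwRay (q.2 : X) q.1 := by
  refine continuous_of_openCells fun j => ?_
  have h1 : ContinuousOn (fun q : I × {x : X // cwDim x = k} => (map k j).symm (q.2 : X))
      {q | (q.2 : X) ∈ openCell k j} :=
    (continuousOn_symm k j).comp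
      (continuous_subtype_val.comp continuous_snd).continuousOn fun q hq => by
      rw [← openCell_eq_target]
      exact hq
  have h2 : ContinuousOn (fun q : I × {x : X // cwDim x = k} =>
      map k j ((q.1 : ℝ) • (map k j).symm (q.2 : X))) {q | (q.2 : X) ∈ openCell k j} := by
    refine (continuousOn k j).comp (ContinuousOn.smul
      (continuous_subtype_val.comp continuous_fst).continuousOn h1) fun q hq => ?_
    have hq' : (map k j).symm (q.2 : X) ∈ ball 0 1 := by
      rw [← source_eq k j]
      refine (map k j).map_target ?_
      rw [← openCell_eq_target]
      exact hq
    rw [mem_ball_zero_iff] at hq'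
    rw [mem_closedBall_zero_iff, norm_smul, Real.norm_eq_abs, abs_of_nonneg q.1.2.1]
    exact mul_le_one₀ q.1.2.2 (norm_nonneg _) hq'.le
  exact h2.congr fun q hq => cwRay_eq_map_symm hq _

theorem nullhomotopic_cwDim_eq [PathConnectedSpace X] (k : ℕ) :
    (ContinuousMap.mk (Subtype.val : {x : X // cwDim x = k} → X)
      continuous_subtype_val).Nullhomotopic := by
  obtain ⟨x₀⟩ := (inferInstance : Nonempty X)
  let p : ∀ y : X, Path y x₀ := fun y => PathConnectedSpace.somePath y x₀
  have hcongr : ∀ {y z : X}, y = z → ∀ t, p y t = p z t := by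
    rintro y _ rfl t
    rfl
  have hray := continuous_cwRay (X := X) k
  let c : C({x : X // cwDim x = k}, X) :=
    ⟨fun x => cwRay (x : X) 0, by
      have : Continuous fun x : {x : X // cwDim x = k} => ((0 : I), x) := by fun_prop
      exact hray.comp this⟩
  -- The paths are chosen arbitrarily, but the centre is constant on each open cell.
  have hp : Continuous fun q : I × {x : X // cwDim x = k} => p (cwRay (q.2 : X) 0) q.1 := by
    refine continuous_of_openCells fun j => ?_
    have : Continuous fun q : I × {x : X // cwDim x = k} => p (map k j 0) q.1 := by fun_prop
    refine this.continuousOn.congr fun q hq => ?_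
    have h0 : cwRay (q.2 : X) 0 = map k j 0 := by rw [cwRay_eq_map_symm hq, zero_smul]
    exact hcongr h0 q.1
  refine ⟨x₀, (ContinuousMap.Homotopic.symm ⟨?_⟩ : ContinuousMap.Homotopic _ c).trans ⟨?_⟩⟩
  · exact
      { toFun := fun q => cwRay (q.2 : X) q.1
        continuous_toFun := hray
        map_zero_left := fun x => by simp [c]
        map_one_left := fun x => by simp [cwRay_one] }
  · exact
      { toFun := fun q => p (cwRay (q.2 : X) 0) q.1
        continuous_toFun := hp
        map_zero_left := fun x => by simp [c]
        map_one_left := fun x => by simp }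

theorem nullhomotopic_cwHeight_lt [PathConnectedSpace X] (k : ℕ) :
    (ContinuousMap.mk (Subtype.val : {x : X | cwHeight k x < cwHeight (k + 1) x} → X)
      continuous_subtype_val).Nullhomotopic := by
  let A : Set X := {x | cwHeight k x < cwHeight (k + 1) x}
  have hinv : Continuous fun x : A => (cwHeight (k + 1) (x : X))⁻¹ :=
    ((continuous_cwHeight (k + 1)).comp continuous_subtype_val).inv₀ fun x =>
      ((cwHeight_mem_Icc k (x : X)).1.trans_lt x.2).ne'
  have hflow : Continuous fun q : X × ℝ => cwFlowMap q.1 q.2 :=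
    continuous_eval.comp ((continuous_cwFlowMap.comp continuous_fst).prodMk continuous_snd)
  have hdim : ∀ x : A, cwDim (cwFlowMap (x : X) (cwHeight (k + 1) (x : X))⁻¹) = k := by
    intro x
    simp only [cwFlowMap, ContinuousMap.coe_mk]
    rw [max_eq_right (one_le_inv_cwHeight x.2)]
    exact cwDim_cwFlow x.2
  let r : C(A, {x : X // cwDim x = k}) :=
    ⟨fun x => ⟨cwFlowMap (x : X) (cwHeight (k + 1) (x : X))⁻¹, hdim x⟩,
      (hflow.comp (continuous_subtype_val.prodMk hinv)).subtype_mk hdim⟩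
  obtain ⟨y, hy⟩ := (nullhomotopic_cwDim_eq (X := X) k).comp_left r
  refine ⟨y, ContinuousMap.Homotopic.trans ⟨?_⟩ hy⟩
  exact
    { toFun := fun q : I × A =>
        cwFlowMap (q.2 : X) (1 + (q.1 : ℝ) * ((cwHeight (k + 1) (q.2 : X))⁻¹ - 1))
      continuous_toFun := by
        have h1 : Continuous fun q : I × A => (cwHeight (k + 1) (q.2 : X))⁻¹ :=
          hinv.comp continuous_snd
        have h2 : Continuous fun q : I × A => ((q.2 : X),
          1 + (q.1 : ℝ) * ((cwHeight (k + 1) (q.2 : X))⁻¹ - 1)) := by fun_prop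
        exact hflow.comp h2
      map_zero_left := fun x => by simp [cwFlowMap, cwFlow_one]
      map_one_left := fun x => by simp [r] }

end CWCategory

/-! ### A partition of unity from a monotone sequence of functions. -/

theorem exists_partitionOfUnity_of_monotone_seq {X : Type*} [TopologicalSpace X]
    {μ : ℕ → X → ℝ} (hc : ∀ k, Continuous (μ k)) (hmono : ∀ x, Monotone fun k => μ k x)
    (h0 : ∀ x, μ 0 x = 0) (h1 : ∀ x, ∃ k, μ k x = 1) :
    ∃ ρ : PartitionOfUnity (ULift.{u} ℕ) X,
      ρ.IsSubordinate fun k => {x | μ k.down x < μ (k.down + 1) x} := by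
  -- Thresholds increasing strictly from `a 0 = 0` and staying below `1 / 2`. The first `k` with `a
  -- k < μ k x` is positive, and the step before it gives a bump equal to `1` near `x`; the bound `1
  -- / 2` gives local finiteness.
  let a : ℕ → ℝ := fun k => 1 / 2 - 1 / (k + 2)
  have ha : ∀ k, a k < a (k + 1) := by
    intro k
    simp only [a]
    have : (1 : ℝ) / ((k + 1 : ℕ) + 2) < 1 / (k + 2) := by
      apply one_div_lt_one_div_of_lt (by positivity)
      push_cast
      linarith
    linarith
  have ha2 : ∀ k, a k < 1 / 2 := by
    intro k
    have : (0 : ℝ) < 1 / (k + 2) := by positivity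
    simp only [a]
    linarith
  -- A tolerance of `2 * ε k` at either threshold uses only half the gap, so `μ k < μ (k + 1)` holds
  -- even on the closed support.
  let ε : ℕ → ℝ := fun k => (a (k + 1) - a k) / 8
  have hε : ∀ k, 0 < ε k := fun k => div_pos (sub_pos.2 (ha k)) (by norm_num)
  let m : ℕ → X → ℝ := fun k x => 2 + min (μ (k + 1) x - a (k + 1)) (a k - μ k x) / ε k
  have hm : ∀ k, Continuous (m k) := by
    intro k
    have := hc k
    have := hc (k + 1)
    fun_prop
  have hmle : ∀ k x, 0 ≤ m k x →
      a (k + 1) - 2 * ε k ≤ μ (k + 1) x ∧ μ k x ≤ a k + 2 * ε k := by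
    intro k x h
    have : -2 ≤ min (μ (k + 1) x - a (k + 1)) (a k - μ k x) / ε k := by linarith
    rw [le_div_iff₀ (hε k), le_min_iff] at this
    constructor <;> linarith [this.1, this.2]
  have h8 : ∀ k, 8 * ε k = a (k + 1) - a k := fun k => by simp only [ε]; ring
  let β : BumpCovering (ULift.{u} ℕ) X :=
    { toFun := fun k => ⟨fun x => max 0 (min 1 (m k.down x)), by have := hm k.down; fun_prop⟩
      locallyFinite' := by
        intro x
        obtain ⟨N, hN⟩ := h1 x
        refine ⟨{y | 1 / 2 < μ N y},
          (isOpen_lt continuous_const (hc N)).mem_nhds (by simp [hN]; norm_num), ?_⟩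
        refine ((finite_lt_nat N).preimage ULift.down_injective.injOn).subset ?_
        rintro k ⟨y, hy, hyN⟩
        by_contra! hk
        have hk' : N ≤ k.down := by simpa using hk
        have hpos : 0 ≤ m k.down y := by
          by_contra! hneg
          apply hy
          simp only [ContinuousMap.coe_mk]
          exact max_eq_left ((min_le_right _ _).trans hneg.le)
        have := (hmle _ _ hpos).2
        have h3 := hmono y hk'
        dsimp only at h3
        replace hyN : 1 / 2 < μ N y := hyN
        linarith [ha2 (k.down + 1), h8 k.down, hε k.down]
      nonneg' := fun k x => le_max_left _ _
      le_one' := fun k x => max_le zero_le_one (min_le_left _ _)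
      eventuallyEq_one' := by
        intro x _
        have hex : ∃ k, a k < μ k x := by
          obtain ⟨N, hN⟩ := h1 x
          exact ⟨N, by rw [hN]; linarith [ha2 N]⟩
        classical
        obtain ⟨k, hk⟩ : ∃ k, Nat.find hex = k + 1 := by
          refine Nat.exists_eq_succ_of_ne_zero fun h => ?_
          have := Nat.find_spec hex
          rw [h, h0] at this
          simp [a] at this
        have h2 : a (k + 1) < μ (k + 1) x := hk ▸ Nat.find_spec hex
        have h3 : μ k x ≤ a k := not_lt.1 (Nat.find_min hex (by omega))
        refine ⟨⟨k⟩, ?_⟩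
        have h4 : 1 < m k x := by
          have : 0 ≤ min (μ (k + 1) x - a (k + 1)) (a k - μ k x) / ε k :=
            div_nonneg (le_min (by linarith) (by linarith)) (hε k).le
          simp only [m]
          linarith
        filter_upwards [(isOpen_lt continuous_const (hm k)).mem_nhds h4] with y hy
        replace hy : 1 < m k y := hy
        simp [hy.le] }
  refine ⟨β.toPartitionOfUnity, BumpCovering.IsSubordinate.toPartitionOfUnity fun k => ?_⟩
  have hcl : tsupport (β k) ⊆ {x | 0 ≤ m k.down x} := by
    refine closure_minimal (fun x hx => ?_) (isClosed_le continuous_const (hm _))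
    by_contra! hneg
    apply hx
    exact max_eq_left ((min_le_right _ _).trans (not_le.1 hneg).le)
  intro x hx
  have h2 := hmle _ _ (hcl hx)
  change μ k.down x < μ (k.down + 1) x
  linarith [h2.1, h2.2, h8 k.down, hε k.down]

/-! ### Connected CW complexes. -/

section CWMain

open Topology.CWComplex Metric

variable {X : Type u} [TopologicalSpace X] [T2Space X] [Topology.CWComplex (univ : Set X)]

theorem hasNumerableCategory_of_cwComplex [PathConnectedSpace X] : HasNumerableCategory X := by
  refine ⟨ULift.{u} ℕ, fun k => {x | cwHeight k.down x < cwHeight (k.down + 1) x},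
    fun k => isOpen_lt (continuous_cwHeight _) (continuous_cwHeight _),
    fun k => nullhomotopic_cwHeight_lt k.down, ?_⟩
  exact exists_partitionOfUnity_of_monotone_seq continuous_cwHeight
    (fun x k l h => cwHeight_mono h x) cwHeight_zero
    fun x => ⟨cwDim x + 1, cwHeight_of_lt (Nat.lt_succ_self _)⟩

/-- Closed cells are path connected, so each lies in `A` or misses it. Applied to a path component
and its complement, this makes the component clopen. -/
theorem isClosed_of_joined_mem {A : Set X} (hA : ∀ x ∈ A, ∀ y, Joined x y → y ∈ A) :
    IsClosed A := by
  rw [closed (univ : Set X) A (subset_univ _)]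
  intro n j
  by_cases h : (A ∩ closedCell n j).Nonempty
  · obtain ⟨x, hxA, hx⟩ := h
    have : closedCell n j ⊆ A := fun y hy => hA x hxA y (joined_of_mem_closedCell hx hy)
    rw [inter_eq_right.2 this]
    exact isClosed_closedCell
  · rw [not_nonempty_iff_eq_empty.1 h]
    exact isClosed_empty

theorem pathConnectedSpace_of_cwComplex [ConnectedSpace X] : PathConnectedSpace X := by
  refine ⟨inferInstance, fun x y => ?_⟩
  have h : IsClopen (pathComponent x) := by
    refine ⟨isClosed_of_joined_mem fun z hz w hw => hz.trans hw,
      isClosed_compl_iff.1 (isClosed_of_joined_mem fun z hz w hw hw' => hz ?_)⟩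
    exact Joined.trans hw' hw.symm
  have := h.eq_univ ⟨x, mem_pathComponent_self x⟩
  have hy : y ∈ pathComponent x := this ▸ mem_univ y
  exact hy

end CWMain

theorem mainTheorem9 (n : ℕ) (hn : 1 ≤ n) (X : Type u) [TopologicalSpace X] (x₀ : X) :
    (PathConnectedSpace X → HasNumerableCategory X →
      IsHomotopyEquivalence (mapsThroughInclusion n x₀)) ∧
    (∀ [T2Space X] [Topology.CWComplex (Set.univ : Set X)] [ConnectedSpace X],
      PathConnectedSpace X ∧ HasNumerableCategory X ∧
        IsHomotopyEquivalence (mapsThroughInclusion n x₀)) := by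
  refine ⟨fun _ hX => isHomotopyEquivalence_mapsThroughInclusion hn hX x₀, ?_⟩
  intro _ _ _
  have hpc : PathConnectedSpace X := pathConnectedSpace_of_cwComplex
  have hX : HasNumerableCategory X := hasNumerableCategory_of_cwComplex
  exact ⟨hpc, hX, isHomotopyEquivalence_mapsThroughInclusion hn hX x₀⟩
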